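/- **Setting.** Fix complex numbers $\hat a,\hat b,\hat c,\hat d,\hat e,\hat f$ with $\hat a\hat c\neq 0$ and $\lambda\tau\neq 0$, where $\lambda=\hat b^2-\hat a\hat c$ and $\tau=\left(\lambda(\hat d^2-\hat a\hat f)-(\hat b\hat d-\hat a\hat e)^2\right)/\hat a$. Let $y_1(x),y_2(x)$ be the two roots in $y$ of $\hat a y^2+2\hat b xy+\hat c x^2+2\hat d y+2\hat e x+\hat f=0$, expanded as formal Laurent series in $1/x$ at $x=\infty$ (both grow linearly in $x$), and put $\Delta_y=y_2-y_1$. Functions are formal Laurent series in $1/x$ with complex coefficients, and $$(\mathbb E_jf)(x)=f(y_j(x)),\qquad \mathbb Df=\frac{\mathbb E_2f-\mathbb E_1f}{y_2-y_1},\qquad \mathbb Mf=\frac{\mathbb E_1f+\mathbb E_2f}{2}.$$ Let $S(x)=\sum_{n\ge0}u_nx^{-n-1}$ be a formal Stieltjes function with $u_0=1$ and $\det[u_{i+j}]_{i,j=0}^n\neq0$ for all $n\ge0$. Let $P_n$ (monic of degree $n$) and the polynomials $P_{n-1}^{(1)}$ (of degree $n-1$, with $P^{(1)}_{-1}=0$)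 be defined for $n\ge 0$ by $S-P_{n-1}^{(1)}/P_n=\mathcal O(x^{-2n-1})$ as $x\to\infty$: they are the monic orthogonal polynomials related to $S$ and the associated polynomials of the first kind. Let $q_n=P_nS-P^{(1)}_{n-1}$ for $n\ge0$ (so $q_0=S$) and $q_{-1}=1$ be the functions of the second kind. **Theorem.** Suppose that $S$ satisfies the Riccati equation $$A\,\mathbb DS=B\,\mathbb E_1S\,\mathbb E_2S+C\,\mathbb MS+D,$$ where $A,B,C,D$ are polynomials in $x$. Then there are polynomials $l_n,\pi_n,\Theta_n$ ($n\ge-1$) and $A_n$ ($n\ge 0$) in $x$, of degrees bounded uniformly in $n$, with $l_{-1}=C/2$, $\pi_{-1}=0$, $\Theta_{-1}=D$ and $$A_n=A+\frac{\Delta_y^2}{2}\,\pi_{n-1}\qquad(n\ge0),$$ such that for all $n\ge0$ \begin{align*} A_{n+1}\mathbb DP_{n+1}&=(l_n-C/2)\,\mathbb MP_{n+1}-B\,\mathbb MP_n^{(1)}+\Theta_n\,\mathbb MP_n,\\ A_{n+1}\mathbb DP_n^{(1)}&=(l_n+C/2)\,\mathbb MP_n^{(1)}+D\,\mathbb MP_{n+1}+\Theta_n\,\mathbb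 MP_{n-1}^{(1)},\\ A_n\mathbb Dq_n&=(l_{n-1}+C/2)\,\mathbb Mq_n+B\left(2\,\mathbb MS\,\mathbb Mq_n-\mathbb M(Sq_n)\right)+\Theta_{n-1}\,\mathbb Mq_{n-1}. \end{align*} -/

import Mathlib

open Polynomial

noncomputable section

namespace LaguerreHahn

/-- Formal Laurent series in descending powers of the variable `x`: the underlying series is a
Laurent series in `1/x`, so its coefficient of index `k` is the coefficient of `x ^ (-k)`. -/
abbrev Series : Type := LaurentSeries ℂ

/-- The variable `x`. -/
def varX : Series := HahnSeries.single (-1) 1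

/-- A polynomial in `x`, seen as a formal series. -/
def ofPoly : ℂ[X] →ₐ[ℂ] Series := Polynomial.aeval varX

/-- `f = O(x ^ (-m))` as `x → ∞`. -/
def IsBigO (f : Series) (m : ℤ) : Prop := ∀ k : ℤ, k < m → f.coeff k = 0

/-- The composition `f(y(x)) = ∑ f_k y(x) ^ (-k)` of formal series. It is meaningful when `1 / y` has
positive order in `1 / x` (that is, when `y` grows at infinity). The series `f` is written as
`x ^ (-m)` times a power series in `1/x`, where `m` is the order of `f`. -/
def compose (f y : Series) : Series :=
  (y⁻¹) ^ f.order * PowerSeries.heval y⁻¹ (LaurentSeries.powerSeriesPart f)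

/-- A non-uniform lattice of the general (`q`-quadratic) class: a conic
`a y² + 2 b x y + c x² + 2 d y + 2 e x + f = 0` with `a c ≠ 0` and `λ τ ≠ 0`, together with its two
roots `y₁`, `y₂` (in either order) as formal series in descending powers of `x`. -/
structure Lattice where
  (a b c d e f : ℂ)
  a_ne : a ≠ 0
  c_ne : c ≠ 0
  /-- `λ ≠ 0` -/
  lam_ne : b ^ 2 - a * c ≠ 0
  /-- `τ ≠ 0` -/
  tau_ne : ((b ^ 2 - a * c) * (d ^ 2 - a * f) - (b * d - a * e) ^ 2) / a ≠ 0
  (y₁ y₂ : Series)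
  /-- `y₁` and `y₂` are the two roots of the quadratic equation in `y`. -/
  roots : ∀ y : Series,
    ofPoly (C a) * y ^ 2 + 2 * ofPoly (C b * X) * y + ofPoly (C c * X ^ 2) + 2 * ofPoly (C d) * y
      + 2 * ofPoly (C e * X) + ofPoly (C f) = ofPoly (C a) * (y - y₁) * (y - y₂)

namespace Lattice

variable (L : Lattice)

/-- `Δ_y = y₂ - y₁`. -/
def Delta : Series := L.y₂ - L.y₁

/-- `(𝔼₁ f)(x) = f(y₁(x))`. -/
def E₁ (f : Series) : Series := compose f L.y₁

/-- `(𝔼₂ f)(x) = f(y₂(x))`. -/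
def E₂ (f : Series) : Series := compose f L.y₂

/-- The divided difference operator `𝔻`. -/
def D (f : Series) : Series := (L.E₂ f - L.E₁ f) / (L.y₂ - L.y₁)

/-- The companion (averaging) operator `𝕄`. -/
def M (f : Series) : Series := (L.E₁ f + L.E₂ f) / 2

/-- The Riccati equation `A 𝔻S = B 𝔼₁S 𝔼₂S + C 𝕄S + D`. -/
def Riccati (pA pB pC pD : ℂ[X]) (S : Series) : Prop :=
  ofPoly pA * L.D S =
    ofPoly pB * (L.E₁ S * L.E₂ S) + ofPoly pC * L.M S + ofPoly pD

end Lattice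

/-- The formal Stieltjes function `S(x) = ∑_{n ≥ 0} u_n x ^ (-n-1)`. -/
def stieltjes (u : ℕ → ℂ) : Series :=
  HahnSeries.ofPowerSeries ℤ ℂ (PowerSeries.X * PowerSeries.mk u)

/-- Regular normalised moment sequences: `u_0 = 1` and all Hankel determinants are nonzero. -/
def IsRegularMoments (u : ℕ → ℂ) : Prop :=
  u 0 = 1 ∧ ∀ n : ℕ, (Matrix.of fun i j : Fin (n + 1) => u (i + j)).det ≠ 0

/-- `P n` is the sequence of monic orthogonal polynomials related to `S` and `P1 n` (with index
`n ≥ -1`) is the sequence of associated polynomials of the first kind `P_n^{(1)}`: `P_n` and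
`P_{n-1}^{(1)}` are the denominator and the numerator of the diagonal Padé approximant,
`S - P_{n-1}^{(1)} / P_n = O(x ^ (-2n-1))`. For `n = 0` this includes `P_{-1}^{(1)} = 0`. -/
structure IsPade (S : Series) (P : ℕ → ℂ[X]) (P1 : ℤ → ℂ[X]) : Prop where
  monic : ∀ n, (P n).Monic
  natDegree_eq : ∀ n, (P n).natDegree = n
  degree_lt : ∀ n : ℕ, (P1 ((n : ℤ) - 1)).degree < n
  approx : ∀ n : ℕ, IsBigO (S - ofPoly (P1 ((n : ℤ) - 1)) / ofPoly (P n)) (2 * n + 1)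

/-- The functions of the second kind `q_n = P_n S - P_{n-1}^{(1)}` for `n ≥ 0` (so `q_0 = S`), with
`q_{-1} = 1` (smaller indices are not used). -/
def secondKind (S : Series) (P : ℕ → ℂ[X]) (P1 : ℤ → ℂ[X]) : ℤ → Series
  | Int.ofNat n => ofPoly (P n) * S - ofPoly (P1 ((n : ℤ) - 1))
  | Int.negSucc _ => 1

end LaguerreHahn

end

noncomputable section

namespace LaguerreHahn

/-! ### The order filtration -/

/-! The Riccati equation says that a bilinear form `β`, with coefficients `B`, `C/2 ± A/Δ` and `D`,
vanishes on the pair `(S,1)` evaluated at `y₁` and at `y₂`. Put `v = (P_{n-1}^{(1)}, P_n)` and let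
`v'` be its predecessor. The Casoratian of `v` and `v'` is a nonzero constant `w`
(`exists_casorati`), so `v`, `v'` may serve as a new basis; `l`, `π`, `Θ` with index `n-1` are the
coefficients of `β` in it. The structure relations are then linear algebra (`structure_P`,
`structure_R`, `structure_q`).

Two points remain. The coefficients are polynomials because exchanging `y₁` and `y₂` changes the
sign of `Δ`: invariant expressions are polynomials, and antisymmetric ones are `Δ` times polynomials
(`exists_transform`). Their degrees are bounded because, modulo the Riccati equation, every term of
`β` contains a function of the second kind, whose decay cancels the growth of the polynomial next to
it (`riccatiForm_conj`, `isBigO_Delta_mul_riccatiForm`). -/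

theorem isBigO_iff_le_orderTop {f : Series} {m : ℤ} : IsBigO f m ↔ (m : WithTop ℤ) ≤ f.orderTop := by
  rw [HahnSeries.le_orderTop_iff_forall]
  simp [IsBigO]

theorem IsBigO.mono {f : Series} {m k : ℤ} (h : IsBigO f m) (hk : k ≤ m) : IsBigO f k :=
  fun i hi => h i (hi.trans_le hk)

theorem IsBigO.add {f g : Series} {m : ℤ} (hf : IsBigO f m) (hg : IsBigO g m) :
    IsBigO (f + g) m := fun i hi => by simp [hf i hi, hg i hi]

theorem IsBigO.sub {f g : Series} {m : ℤ} (hf : IsBigO f m) (hg : IsBigO g m) :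
    IsBigO (f - g) m := fun i hi => by simp [hf i hi, hg i hi]

theorem IsBigO.neg {f : Series} {m : ℤ} (hf : IsBigO f m) : IsBigO (-f) m :=
  fun i hi => by simp [hf i hi]

theorem IsBigO.mul {f g : Series} {m k : ℤ} (hf : IsBigO f m) (hg : IsBigO g k) :
    IsBigO (f * g) (m + k) := by
  rw [isBigO_iff_le_orderTop] at *
  rw [WithTop.coe_add]
  exact (add_le_add hf hg).trans HahnSeries.orderTop_add_le_mul

theorem IsBigO.pow {f : Series} {m : ℤ} (hf : IsBigO f m) (n : ℕ) : IsBigO (f ^ n) (n * m) := by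
  induction n with
  | zero =>
    simp only [pow_zero, Nat.cast_zero, zero_mul]
    intro i hi
    exact HahnSeries.coeff_eq_zero_of_lt_orderTop (by simpa using hi)
  | succ n ih =>
    rw [pow_succ]
    convert ih.mul hf using 1
    push_cast; ring

theorem isBigO_single (m : ℤ) (a : ℂ) : IsBigO (HahnSeries.single m a : Series) m :=
  fun _ hi => HahnSeries.coeff_single_of_ne hi.ne

theorem IsBigO.zpow {y : Series} (h : IsBigO y 1) (h' : IsBigO y⁻¹ (-1)) (m : ℤ) :
    IsBigO (y ^ m) m := by
  obtain ⟨n, rfl | rfl⟩ := m.eq_nat_or_neg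
  · simpa using h.pow n
  · simpa using h'.pow n

theorem algebraMap_eq_single (a : ℂ) : algebraMap ℂ Series a = HahnSeries.single 0 a := by
  rw [HahnSeries.algebraMap_apply']
  simp

theorem ofPoly_X : ofPoly X = varX := by simp [ofPoly]

theorem ofPoly_C (a : ℂ) : ofPoly (C a) = HahnSeries.single 0 a := by
  rw [← algebraMap_eq_single]; simp [ofPoly]

theorem ofPoly_C_eq_algebraMap (a : ℂ) : ofPoly (C a) = algebraMap ℂ Series a := by
  rw [ofPoly_C, algebraMap_eq_single]

instance : CharZero Series := charZero_of_injective_algebraMap (algebraMap ℂ Series).injective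

theorem varX_pow (n : ℕ) : varX ^ n = HahnSeries.single (-(n : ℤ)) 1 := by
  simp [varX, HahnSeries.single_pow]

theorem ofPoly_coeff (p : ℂ[X]) (n : ℕ) : (ofPoly p).coeff (-(n : ℤ)) = p.coeff n := by
  induction p using Polynomial.induction_on' with
  | add p q hp hq => simp [hp, hq]
  | monomial k a =>
    rw [← C_mul_X_pow_eq_monomial, map_mul, map_pow, ofPoly_C, ofPoly_X, varX_pow,
      HahnSeries.single_mul_single, coeff_C_mul_X_pow]
    simp [HahnSeries.coeff_single]

theorem isBigO_ofPoly {p : ℂ[X]} {N : ℕ} (h : p.natDegree ≤ N) : IsBigO (ofPoly p) (-N) := by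
  rw [p.as_sum_range_C_mul_X_pow, map_sum]
  intro i hi
  rw [HahnSeries.coeff_sum]
  refine Finset.sum_eq_zero fun k hk => ?_
  rw [map_mul, map_pow, ofPoly_C, ofPoly_X, varX_pow, HahnSeries.single_mul_single]
  refine HahnSeries.coeff_single_of_ne ?_
  have := Finset.mem_range.1 hk
  lia

theorem natDegree_le_of_isBigO {p : ℂ[X]} {N : ℕ} (h : IsBigO (ofPoly p) (-N)) :
    p.natDegree ≤ N := by
  refine natDegree_le_iff_coeff_eq_zero.2 fun n hn => ?_
  rw [← ofPoly_coeff]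
  exact h _ (by lia)

theorem ofPoly_injective : Function.Injective ofPoly := fun p q h => by
  ext n
  rw [← ofPoly_coeff, h, ofPoly_coeff]

/-! ### Composition as a ring homomorphism -/

/-- The series `y` is of exact order `x`. -/
structure GrowsLinearly (y : Series) : Prop where
  ne_zero : y ≠ 0
  isBigO : IsBigO y (-1)
  isBigO_inv : IsBigO y⁻¹ 1

namespace GrowsLinearly

variable {y : Series}

theorem orderTop_inv_pos (hy : GrowsLinearly y) : 0 < (y⁻¹).orderTop :=
  lt_of_lt_of_le (by exact_mod_cast zero_lt_one) (isBigO_iff_le_orderTop.1 hy.isBigO_inv)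

theorem of_order (h0 : y ≠ 0) (h : y.order = -1) : GrowsLinearly y := by
  have h1 := HahnSeries.order_mul h0 (inv_ne_zero h0)
  rw [mul_inv_cancel₀ h0, HahnSeries.order_one, h] at h1
  refine ⟨h0, ?_, ?_⟩
  · rw [isBigO_iff_le_orderTop, ← HahnSeries.order_eq_orderTop_of_ne_zero h0, h]
  · rw [isBigO_iff_le_orderTop, ← HahnSeries.order_eq_orderTop_of_ne_zero (inv_ne_zero h0)]
    exact_mod_cast (by lia)

theorem isBigO_heval (hy : GrowsLinearly y) (g : PowerSeries ℂ) :
    IsBigO (PowerSeries.heval y⁻¹ g) 0 := by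
  intro i hi
  rw [PowerSeries.coeff_heval]
  refine finsum_eq_zero_of_forall_eq_zero fun n => ?_
  have := hy.isBigO_inv.pow n i (by lia)
  rw [HahnSeries.SummableFamily.coeff_apply,
    HahnSeries.SummableFamily.powerSeriesFamily_of_orderTop_pos hy.orderTop_inv_pos,
    HahnSeries.coeff_smul, this, smul_zero]

/-- Evaluation of power series at `1 / y`, as a ring homomorphism. -/
def hevalHom (y : Series) : PowerSeries ℂ →+* Series where
  toFun g := PowerSeries.heval y⁻¹ g
  map_one' := map_one _
  map_mul' _ _ := PowerSeries.heval_mul _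
  map_zero' := map_zero _
  map_add' := map_add _

/-- Composition with a series which grows linearly, as a ring homomorphism. -/
def composeHom (hy : GrowsLinearly y) : Series →+* Series :=
  -- Laurent series are power series localized at the powers of the variable, which is sent to the
  -- unit `1 / y`.
  IsLocalization.lift (M := Submonoid.powers (PowerSeries.X : PowerSeries ℂ))
    (g := hevalHom y) <| by
      rintro ⟨_, n, rfl⟩
      rw [map_pow]
      refine IsUnit.pow n ?_
      simp only [hevalHom, RingHom.coe_mk, MonoidHom.coe_mk, OneHom.coe_mk,
        PowerSeries.heval_X _ hy.orderTop_inv_pos]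
      exact (inv_ne_zero hy.ne_zero).isUnit

theorem composeHom_ofPowerSeries (hy : GrowsLinearly y) (g : PowerSeries ℂ) :
    hy.composeHom (HahnSeries.ofPowerSeries ℤ ℂ g) = PowerSeries.heval y⁻¹ g :=
  IsLocalization.lift_eq (M := Submonoid.powers (PowerSeries.X : PowerSeries ℂ)) _ _

theorem composeHom_single (hy : GrowsLinearly y) (k : ℤ) :
    hy.composeHom (HahnSeries.single k 1) = y⁻¹ ^ k := by
  rw [RatFunc.single_zpow, map_zpow₀, ← HahnSeries.ofPowerSeries_X, composeHom_ofPowerSeries,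
    PowerSeries.heval_X _ hy.orderTop_inv_pos]

/-- The definition of `compose` splits off a power depending on the order of `f`, which hides
additivity; a ring homomorphism applied to the same factorization gives the same value. -/
theorem compose_eq (hy : GrowsLinearly y) (f : Series) : compose f y = hy.composeHom f := by
  conv_rhs => rw [← LaurentSeries.single_order_mul_powerSeriesPart f]
  rw [map_mul, composeHom_single, composeHom_ofPowerSeries, compose]

theorem composeHom_ofPoly (hy : GrowsLinearly y) (p : ℂ[X]) :
    hy.composeHom (ofPoly p) = aeval y p := by
  induction p using Polynomial.induction_on' with
  | add p q hp hq => simp [hp, hq]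
  | monomial k a =>
    rw [← C_mul_X_pow_eq_monomial, map_mul, map_pow, ofPoly_C, ofPoly_X, map_mul, map_pow,
      varX, composeHom_single, ← HahnSeries.C_apply, ← HahnSeries.ofPowerSeries_C,
      composeHom_ofPowerSeries, PowerSeries.heval_C]
    have h : (a • 1 : Series) = HahnSeries.single 0 a := by
      ext i
      simp [HahnSeries.coeff_single, HahnSeries.coeff_one]
    simp [algebraMap_eq_single, h]

theorem isBigO_composeHom (hy : GrowsLinearly y) {f : Series} {m : ℤ} (hf : IsBigO f m) :
    IsBigO (hy.composeHom f) m := by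
  obtain rfl | h0 := eq_or_ne f 0
  · simpa using hf
  have hm : m ≤ f.order := by
    rw [isBigO_iff_le_orderTop, ← HahnSeries.order_eq_orderTop_of_ne_zero h0] at hf
    exact_mod_cast hf
  rw [← hy.compose_eq, compose]
  have h := (hy.isBigO_inv.zpow (by simpa using hy.isBigO) f.order).mul
    (hy.isBigO_heval (LaurentSeries.powerSeriesPart f))
  exact h.mono (by simpa using hm)

end GrowsLinearly

/-! ### The roots of the conic -/

namespace Lattice

variable (L : Lattice)

/-- Vieta, obtained by evaluating the factorization at `y = 0`; the sum of the roots uses `y = 1` as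
well. -/
theorem y_mul_y : L.y₁ * L.y₂ = ofPoly (C (1 / L.a) * (C L.c * X ^ 2 + 2 * C L.e * X + C L.f)) := by
  have ha : ofPoly (C L.a) * ofPoly (C (1 / L.a)) = 1 := by
    rw [← map_mul, ← C_mul, mul_one_div_cancel L.a_ne]; simp
  have h := L.roots 0
  simp only [map_mul, map_add, map_pow, map_ofNat] at h ⊢
  linear_combination (-(L.y₁ * L.y₂)) * ha - ofPoly (C (1 / L.a)) * h

theorem y_add_y : L.y₁ + L.y₂ = ofPoly (C (-2 / L.a) * (C L.b * X + C L.d)) := by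
  have ha : ofPoly (C L.a) * ofPoly (C (-2 / L.a)) = -2 := by
    rw [← map_mul, ← C_mul, mul_div_cancel₀ _ L.a_ne]; simp [map_ofNat]
  have h0 := L.roots 0
  have h1 := L.roots 1
  have ha' : ofPoly (C L.a) ≠ 0 := by
    rw [ne_eq, map_eq_zero_iff _ ofPoly_injective]
    simpa using L.a_ne
  refine mul_left_cancel₀ ha' ?_
  simp only [map_mul, map_add, map_pow] at h0 h1 ⊢
  linear_combination h1 - h0 - (ofPoly (C L.b) * ofPoly X + ofPoly (C L.d)) * ha

/-- The orders add up to `-2`, so if one is below `-1` the other is above it, and the leading term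
of `u` survives in `u + v`. -/
theorem neg_one_le_order {u v : Series} (hu : u ≠ 0) (hv : v ≠ 0) (h : (u * v).order = -2)
    (h' : IsBigO (u + v) (-1)) : -1 ≤ u.order := by
  rw [HahnSeries.order_mul hu hv] at h
  by_contra! hlt
  have h1 := h' u.order hlt
  rw [HahnSeries.coeff_add, HahnSeries.coeff_eq_zero_of_lt_order (x := v) (by lia), add_zero] at h1
  exact hu (HahnSeries.coeff_order_eq_zero.1 h1)

theorem growsLinearly : GrowsLinearly L.y₁ ∧ GrowsLinearly L.y₂ := by
  set p := C (1 / L.a) * (C L.c * X ^ 2 + 2 * C L.e * X + C L.f) with hp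
  have hdeg : IsBigO (ofPoly p) (-(2 : ℕ)) := isBigO_ofPoly (by rw [hp]; compute_degree)
  have hcoeff : (ofPoly p).coeff (-(2 : ℕ)) ≠ 0 := by
    rw [ofPoly_coeff, hp]
    have : C (1 / L.a) * (C L.c * X ^ 2 + 2 * C L.e * X + C L.f) =
        C (L.c / L.a) * X ^ 2 + C (2 * L.e / L.a) * X + C (L.f / L.a) := by
      refine Polynomial.funext fun x => ?_
      simp only [eval_pow, eval_mul, eval_add, eval_C, eval_X, eval_ofNat]
      ring
    rw [this]
    simp [L.a_ne, L.c_ne]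
  have hmul : (L.y₁ * L.y₂).order = -2 := by
    rw [y_mul_y]
    refine le_antisymm (HahnSeries.order_le_of_coeff_ne_zero hcoeff) ?_
    by_contra! hlt
    have := hdeg _ hlt
    rw [HahnSeries.coeff_order_eq_zero] at this
    rw [this] at hcoeff
    simp at hcoeff
  have hadd : IsBigO (L.y₁ + L.y₂) (-1) := by
    rw [y_add_y]
    exact isBigO_ofPoly (N := 1) (by compute_degree)
  have h0 : L.y₁ * L.y₂ ≠ 0 := by
    intro h
    simp [h] at hmul
  have h1 := left_ne_zero_of_mul h0
  have h2 := right_ne_zero_of_mul h0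
  have h3 := neg_one_le_order h1 h2 hmul hadd
  have h4 := neg_one_le_order h2 h1 (by rwa [mul_comm]) (by rwa [add_comm])
  rw [HahnSeries.order_mul h1 h2] at hmul
  exact ⟨.of_order h1 (by lia), .of_order h2 (by lia)⟩

/-- The operator `𝔼₁` as a ring homomorphism. -/
def hom₁ : Series →+* Series := L.growsLinearly.1.composeHom

/-- The operator `𝔼₂` as a ring homomorphism. -/
def hom₂ : Series →+* Series := L.growsLinearly.2.composeHom

theorem E₁_eq (f : Series) : L.E₁ f = L.hom₁ f := L.growsLinearly.1.compose_eq f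

theorem E₂_eq (f : Series) : L.E₂ f = L.hom₂ f := L.growsLinearly.2.compose_eq f

/-- The polynomial equal to `Δ_y ^ 2`. -/
def deltaSq : ℂ[X] :=
  (C (-2 / L.a) * (C L.b * X + C L.d)) ^ 2 -
    4 * (C (1 / L.a) * (C L.c * X ^ 2 + 2 * C L.e * X + C L.f))

theorem ofPoly_deltaSq : ofPoly L.deltaSq = L.Delta ^ 2 := by
  rw [deltaSq, map_sub, map_pow, map_mul ofPoly 4, ← y_add_y, ← y_mul_y, Delta, map_ofNat]
  ring

theorem deltaSq_ne_zero : L.deltaSq ≠ 0 := by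
  intro h
  have h2 : L.deltaSq.coeff 2 = 4 * (L.b ^ 2 - L.a * L.c) / L.a ^ 2 := by
    have h4 : L.deltaSq = C (4 * (L.b ^ 2 - L.a * L.c) / L.a ^ 2) * X ^ 2 +
        C (8 * (L.b * L.d - L.a * L.e) / L.a ^ 2) * X +
        C (4 * (L.d ^ 2 - L.a * L.f) / L.a ^ 2) := by
      refine Polynomial.funext fun x => ?_
      have := L.a_ne
      simp only [deltaSq, eval_sub, eval_pow, eval_mul, eval_add, eval_C, eval_X, eval_ofNat]
      field_simp
      ring
    rw [h4]
    simp
  rw [h, coeff_zero] at h2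
  exact div_ne_zero (mul_ne_zero (by norm_num) L.lam_ne) (pow_ne_zero 2 L.a_ne) h2.symm

theorem Delta_ne_zero : L.Delta ≠ 0 := by
  intro h
  apply L.deltaSq_ne_zero
  apply ofPoly_injective
  rw [ofPoly_deltaSq, h]
  simp

theorem isBigO_Delta : IsBigO L.Delta (-1) :=
  L.growsLinearly.2.isBigO.sub L.growsLinearly.1.isBigO

/-- `𝔻` and `𝕄` map polynomials to polynomials. -/
theorem exists_M_D_poly (p : ℂ[X]) : ∃ m d : ℂ[X],
    L.hom₁ (ofPoly p) = ofPoly m - L.Delta / 2 * ofPoly d ∧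
    L.hom₂ (ofPoly p) = ofPoly m + L.Delta / 2 * ofPoly d := by
  rw [hom₁, hom₂, GrowsLinearly.composeHom_ofPoly, GrowsLinearly.composeHom_ofPoly]
  have hy := L.y_add_y
  induction p using Polynomial.induction_on with
  | C a => exact ⟨C a, 0, by simp [ofPoly], by simp [ofPoly]⟩
  | add p q hp hq =>
    obtain ⟨m, d, h1, h2⟩ := hp
    obtain ⟨m', d', h1', h2'⟩ := hq
    refine ⟨m + m', d + d', ?_, ?_⟩ <;> simp only [map_add, h1, h2, h1', h2'] <;> ring
  | monomial n a h =>
    obtain ⟨m, d, h1, h2⟩ := h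
    set s : ℂ[X] := C (-2 / L.a) * (C L.b * X + C L.d)
    have hh : ofPoly (C (1 / 2)) = 1 / 2 := by
      rw [ofPoly_C_eq_algebraMap, map_div₀, map_one, map_ofNat (algebraMap ℂ Series) 2]
    have hq : ofPoly (C (1 / 4)) = 1 / 4 := by
      rw [ofPoly_C_eq_algebraMap, map_div₀, map_one, map_ofNat (algebraMap ℂ Series) 4]
    -- Multiplication of `m ∓ (Δ/2) d` by `y = (s ∓ Δ)/2`, where `s = y₁ + y₂`.
    refine ⟨C (1 / 2) * s * m + C (1 / 4) * L.deltaSq * d, C (1 / 2) * s * d + m, ?_, ?_⟩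
    · rw [pow_succ, ← mul_assoc, map_mul, h1, aeval_X]
      simp only [map_add, map_mul, ofPoly_deltaSq, hh, hq, ← hy, Delta]
      ring
    · rw [pow_succ, ← mul_assoc, map_mul, h2, aeval_X]
      simp only [map_add, map_mul, ofPoly_deltaSq, hh, hq, ← hy, Delta]
      ring

end Lattice
-- Padé approximants, functions of the second kind and the Casoratian
theorem ofPoly_coeff_of_pos (p : ℂ[X]) {i : ℤ} (hi : 0 < i) : (ofPoly p).coeff i = 0 := by
  induction p using Polynomial.induction_on' with
  | add p q hp hq => simp [hp, hq]
  | monomial k a =>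
    rw [← C_mul_X_pow_eq_monomial, map_mul, map_pow, ofPoly_C, ofPoly_X, varX_pow,
      HahnSeries.single_mul_single]
    exact HahnSeries.coeff_single_of_ne (by lia)

theorem isBigO_const (a : ℂ) : IsBigO (ofPoly (C a)) 0 :=
  isBigO_ofPoly (N := 0) (natDegree_C a).le

theorem stieltjes_coeff (u : ℕ → ℂ) (k : ℕ) : (stieltjes u).coeff ((k : ℤ) + 1) = u k := by
  rw [stieltjes, show (k : ℤ) + 1 = ((k + 1 : ℕ) : ℤ) by push_cast; rfl,
    LaurentSeries.coeff_coe_powerSeries, PowerSeries.coeff_succ_X_mul, PowerSeries.coeff_mk]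

theorem isBigO_stieltjes (u : ℕ → ℂ) : IsBigO (stieltjes u) 1 := by
  rw [stieltjes, map_mul, HahnSeries.ofPowerSeries_X]
  refine (isBigO_single 1 1).mul (k := 0) fun i hi => ?_
  rw [PowerSeries.coeff_coe, if_pos hi]

theorem ofPoly_mul_stieltjes_coeff (u : ℕ → ℂ) {p : ℂ[X]} {n : ℕ} (hp : p.natDegree ≤ n) (k : ℕ) :
    (ofPoly p * stieltjes u).coeff ((k : ℤ) + 1) = ∑ i : Fin (n + 1), u (k + i) * p.coeff i := by
  rw [p.as_sum_range_C_mul_X_pow' (Nat.lt_succ_of_le hp), map_sum, Finset.sum_mul,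
    HahnSeries.coeff_sum, Finset.sum_range]
  refine Finset.sum_congr rfl fun i _ => ?_
  rw [← p.as_sum_range_C_mul_X_pow' (Nat.lt_succ_of_le hp), map_mul, map_pow, ofPoly_C, ofPoly_X,
    varX_pow, HahnSeries.single_mul_single,
    show (k : ℤ) + 1 = (((k + i : ℕ) : ℤ) + 1) + (0 + -(i : ℕ)) by push_cast; ring,
    HahnSeries.coeff_single_mul_add, stieltjes_coeff]
  ring

/-- A monic polynomial of degree `n` is not orthogonal to all powers `x ^ k` with `k ≤ n`. -/
theorem exists_ofPoly_mul_stieltjes_coeff_ne_zero {u : ℕ → ℂ} (hu : IsRegularMoments u)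
    {p : ℂ[X]} (hp : p.Monic) :
    ∃ k : ℕ, k ≤ p.natDegree ∧ (ofPoly p * stieltjes u).coeff ((k : ℤ) + 1) ≠ 0 := by
  by_contra! h
  -- Otherwise the coefficient vector lies in the kernel of a nonsingular Hankel matrix, although
  -- its last entry is `1`.
  have hv := Matrix.eq_zero_of_mulVec_eq_zero (hu.2 p.natDegree)
    (v := fun i => p.coeff i) (by
      ext j
      rw [Matrix.mulVec, dotProduct]
      have := h j (Nat.lt_succ_iff.1 j.2)
      rw [ofPoly_mul_stieltjes_coeff u le_rfl] at this
      simpa using this)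
  have := congrFun hv (Fin.last _)
  simp [hp] at this

namespace IsPade

variable {u : ℕ → ℂ} {P : ℕ → ℂ[X]} {P1 : ℤ → ℂ[X]}

theorem isBigO_secondKind {S : Series} (hP : IsPade S P P1) (n : ℕ) :
    IsBigO (secondKind S P P1 n) (n + 1) := by
  have h0 : ofPoly (P n) ≠ 0 := by
    rw [ne_eq, map_eq_zero_iff _ ofPoly_injective]
    exact (hP.monic n).ne_zero
  have h : secondKind S P P1 n = ofPoly (P n) * (S - ofPoly (P1 ((n : ℤ) - 1)) / ofPoly (P n)) := by
    rw [mul_sub, mul_div_cancel₀ _ h0]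
    rfl
  rw [h]
  exact ((isBigO_ofPoly (hP.natDegree_eq n).le).mul (hP.approx n)).mono (by lia)

/-- `P_{n-1}`, with `P_{-1} = 0`. -/
def prevP (P : ℕ → ℂ[X]) : ℕ → ℂ[X]
  | 0 => 0
  | n + 1 => P n

/-- `P_{n-2}^{(1)}`, with `P_{-2}^{(1)} = -1`. -/
def prevP1 (P1 : ℤ → ℂ[X]) : ℕ → ℂ[X]
  | 0 => -1
  | n + 1 => P1 ((n : ℤ) - 1)

theorem secondKind_eq (S : Series) (n : ℕ) :
    secondKind S P P1 n = ofPoly (P n) * S - ofPoly (P1 ((n : ℤ) - 1)) := rfl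

/-- The conventions `P_{-1} = 0` and `P_{-2}^{(1)} = -1` make `q_{-1} = 1` an instance of the
general formula. -/
theorem secondKind_pred_eq (S : Series) (n : ℕ) :
    secondKind S P P1 ((n : ℤ) - 1) = ofPoly (prevP P n) * S - ofPoly (prevP1 P1 n) := by
  cases n with
  | zero =>
    have : secondKind S P P1 (-1) = 1 := rfl
    simp [this, prevP, prevP1]
  | succ n =>
    rw [Nat.cast_succ, add_sub_cancel_right]
    rfl

theorem isBigO_secondKind_pred {S : Series} (hP : IsPade S P P1) (n : ℕ) :
    IsBigO (secondKind S P P1 ((n : ℤ) - 1)) n := by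
  cases n with
  | zero =>
    have h : secondKind S P P1 (((0 : ℕ) : ℤ) - 1) = ofPoly (C 1) := by
      rw [map_one, map_one]
      rfl
    rw [h]
    exact isBigO_const 1
  | succ n =>
    rw [Nat.cast_succ, add_sub_cancel_right]
    exact hP.isBigO_secondKind n

theorem natDegree_prevP_le {S : Series} (hP : IsPade S P P1) (n : ℕ) :
    (prevP P n).natDegree ≤ n := by
  cases n with
  | zero => simp [prevP]
  | succ n => exact (hP.natDegree_eq n).le.trans n.le_succ

theorem secondKind_coeff_ne_zero (hu : IsRegularMoments u) (hP : IsPade (stieltjes u) P P1)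
    (n : ℕ) : ∃ k : ℕ, k ≤ n ∧ (secondKind (stieltjes u) P P1 n).coeff ((k : ℤ) + 1) ≠ 0 := by
  obtain ⟨k, hk, h⟩ := exists_ofPoly_mul_stieltjes_coeff_ne_zero hu (hP.monic n)
  refine ⟨k, hk.trans (hP.natDegree_eq n).le, ?_⟩
  rwa [secondKind_eq, HahnSeries.coeff_sub, ofPoly_coeff_of_pos _ (by lia), sub_zero]

/-- The Casorati determinant of `P_n` and `P_{n-1}^{(1)}` is a nonzero constant. -/
theorem exists_casorati (hu : IsRegularMoments u) (hP : IsPade (stieltjes u) P P1) (n : ℕ) :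
    ∃ w : ℂ, w ≠ 0 ∧ P n * prevP1 P1 n - prevP P n * P1 ((n : ℤ) - 1) = C w := by
  cases n with
  | zero =>
    refine ⟨-1, by simp, ?_⟩
    have : P 0 = 1 := (hP.monic 0).natDegree_eq_zero.1 (hP.natDegree_eq 0)
    simp [prevP, prevP1, this]
  | succ n =>
    set W := P (n + 1) * prevP1 P1 (n + 1) - prevP P (n + 1) * P1 (((n + 1 : ℕ) : ℤ) - 1) with hW
    -- The terms with `S` cancel, and the two products left are `O(x ^ (-2))` and `O(1)`, so `W` is
    -- constant.
    have hWq : ofPoly W = ofPoly (P n) * secondKind (stieltjes u) P P1 (n + 1 : ℕ) -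
        ofPoly (P (n + 1)) * secondKind (stieltjes u) P P1 n := by
      rw [secondKind_eq, secondKind_eq, hW, map_sub, map_mul, map_mul, prevP, prevP1]
      ring
    have h1 : IsBigO (ofPoly (P n) * secondKind (stieltjes u) P P1 (n + 1 : ℕ)) 2 :=
      ((isBigO_ofPoly (hP.natDegree_eq n).le).mul (hP.isBigO_secondKind (n + 1))).mono
        (by push_cast; lia)
    have h2 : IsBigO (ofPoly (P (n + 1)) * secondKind (stieltjes u) P P1 n) 0 :=
      ((isBigO_ofPoly (hP.natDegree_eq (n + 1)).le).mul (hP.isBigO_secondKind n)).mono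
        (by push_cast; lia)
    have hdeg : W.natDegree ≤ 0 :=
      natDegree_le_of_isBigO (by rw [hWq]; exact (h1.mono (by lia)).sub h2)
    refine ⟨W.coeff 0, fun h0 => ?_, eq_C_of_natDegree_le_zero hdeg⟩
    -- If `W = 0`, then `P_{n+1} q_n = P_n q_{n+1} = O(x ^ (-2))`; but `q_n` has order at most `n +
    -- 1` by regularity, so `P_{n+1} q_n` has order at most `0`.
    rw [eq_C_of_natDegree_le_zero hdeg, h0, map_zero, map_zero, eq_comm, sub_eq_zero] at hWq
    rw [hWq] at h1
    obtain ⟨k, hk, hne⟩ := hP.secondKind_coeff_ne_zero hu n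
    have hq0 : secondKind (stieltjes u) P P1 n ≠ 0 := fun h => hne (by rw [h]; rfl)
    have hp0 : ofPoly (P (n + 1)) ≠ 0 := by
      rw [ne_eq, map_eq_zero_iff _ ofPoly_injective]
      exact (hP.monic _).ne_zero
    have h3 : (ofPoly (P (n + 1))).order ≤ -((n + 1 : ℕ) : ℤ) := by
      refine HahnSeries.order_le_of_coeff_ne_zero ?_
      rw [ofPoly_coeff]
      have := (hP.monic (n + 1)).coeff_natDegree
      rw [hP.natDegree_eq] at this
      simp [this]
    have h4 := HahnSeries.order_le_of_coeff_ne_zero hne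
    rw [isBigO_iff_le_orderTop,
      ← HahnSeries.order_eq_orderTop_of_ne_zero (mul_ne_zero hp0 hq0)] at h1
    have h5 : (2 : ℤ) ≤ _ := WithTop.coe_le_coe.1 h1
    rw [HahnSeries.order_mul hp0 hq0] at h5
    push_cast at h3
    lia

end IsPade
/-! ### The transformed Riccati form -/

section Form

variable {F : Type*} [Field F]

/-- The bilinear form attached to the Riccati equation, with `c = C / 2` and `a = A / Δ`. -/
def riccatiForm (B c a D r₁ p₁ r₂ p₂ : F) : F :=
  B * r₁ * r₂ + (c + a) * r₁ * p₂ + (c - a) * p₁ * r₂ + D * p₁ * p₂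

variable {B c a D w l π Θ P₁ P₂ R₁ R₂ P₁' P₂' R₁' R₂' S₁ S₂ : F}

/-- `l`, `π` (which includes the factor `Δ`) and `Θ` are the coefficients of the Riccati form after
the change of basis with the entries `P`, `R`, `P'`, `R'`. -/
structure IsTransform (B c a D w l π Θ P₁ P₂ R₁ R₂ P₁' P₂' R₁' R₂' : F) : Prop where
  casorati₁ : P₁ * R₁' - P₁' * R₁ = w
  casorati₂ : P₂ * R₂' - P₂' * R₂ = w
  l_eq : 2 * w * l = riccatiForm B c a D R₁' P₁' R₂ P₂ + riccatiForm B c a D R₁ P₁ R₂' P₂'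
  π_eq : 2 * w * π = riccatiForm B c a D R₁' P₁' R₂ P₂ - riccatiForm B c a D R₁ P₁ R₂' P₂' - 2 * w * a
  Θ_eq : w * Θ = -riccatiForm B c a D R₁ P₁ R₂ P₂

namespace IsTransform

/-- With `v = (R, P)` and `v' = (R', P')`, the Casoratian gives `P v' - P' v = (w, 0)`. Inserting
this in either slot of the form, with `v` in the other, and adding the two results yields the
relation. -/
theorem structure_P [CharZero F] (h : IsTransform B c a D w l π Θ P₁ P₂ R₁ R₂ P₁' P₂' R₁' R₂')
    (hw : w ≠ 0) :
    (a + π / 2) * (P₂ - P₁) = (l - c) * ((P₁ + P₂) / 2) - B * ((R₁ + R₂) / 2)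
      + Θ * ((P₁' + P₂') / 2) := by
  obtain ⟨h1, h2, hl, hπ, hΘ⟩ := h
  refine mul_left_cancel₀ (mul_ne_zero (by norm_num : (4 : F) ≠ 0) hw) ?_
  simp only [riccatiForm] at hl hπ hΘ
  linear_combination (P₂ - P₁) * hπ - (P₁ + P₂) * hl - 2 * (P₁' + P₂') * hΘ
    - 2 * (B * R₂ + (c + a) * P₂) * h1 - 2 * (B * R₁ + (c - a) * P₁) * h2

/-- Same argument, from `R v' - R' v = (0, -w)`. -/
theorem structure_R [CharZero F] (h : IsTransform B c a D w l π Θ P₁ P₂ R₁ R₂ P₁' P₂' R₁' R₂')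
    (hw : w ≠ 0) :
    (a + π / 2) * (R₂ - R₁) = (l + c) * ((R₁ + R₂) / 2) + D * ((P₁ + P₂) / 2)
      + Θ * ((R₁' + R₂') / 2) := by
  obtain ⟨h1, h2, hl, hπ, hΘ⟩ := h
  refine mul_left_cancel₀ (mul_ne_zero (by norm_num : (4 : F) ≠ 0) hw) ?_
  simp only [riccatiForm] at hl hπ hΘ
  linear_combination (R₂ - R₁) * hπ - (R₁ + R₂) * hl - 2 * (R₁' + R₂') * hΘ
    + 2 * ((c - a) * R₂ + D * P₂) * h1 + 2 * ((c + a) * R₁ + D * P₁) * h2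

/-- Same argument with `q = P S - R`: now `q v' - q' v = w (S, 1)`, and `hS` removes the part of the
other slot along `(S, 1)`. -/
theorem structure_q [CharZero F] (h : IsTransform B c a D w l π Θ P₁ P₂ R₁ R₂ P₁' P₂' R₁' R₂')
    (hw : w ≠ 0) (hS : riccatiForm B c a D S₁ 1 S₂ 1 = 0) :
    (a + π / 2) * ((P₂ * S₂ - R₂) - (P₁ * S₁ - R₁)) =
      (l + c) * (((P₁ * S₁ - R₁) + (P₂ * S₂ - R₂)) / 2)
      + B * (2 * ((S₁ + S₂) / 2) * (((P₁ * S₁ - R₁) + (P₂ * S₂ - R₂)) / 2)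
        - (S₁ * (P₁ * S₁ - R₁) + S₂ * (P₂ * S₂ - R₂)) / 2)
      + Θ * (((P₁' * S₁ - R₁') + (P₂' * S₂ - R₂')) / 2) := by
  obtain ⟨h1, h2, hl, hπ, hΘ⟩ := h
  refine mul_left_cancel₀ (mul_ne_zero (by norm_num : (4 : F) ≠ 0) hw) ?_
  simp only [riccatiForm] at hl hπ hΘ hS
  linear_combination ((P₂ * S₂ - R₂) - (P₁ * S₁ - R₁)) * hπ
    - ((P₁ * S₁ - R₁) + (P₂ * S₂ - R₂)) * hl
    - 2 * ((P₁' * S₁ - R₁') + (P₂' * S₂ - R₂')) * hΘ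
    - 2 * ((R₁ * B + P₁ * (c - a)) * S₂ + R₁ * (c + a) + P₁ * D) * h2
    - 2 * ((R₂ * B + P₂ * (c + a)) * S₁ + R₂ * (c - a) + P₂ * D) * h1
    - 2 * w * (P₁ + P₂) * hS

end IsTransform

/-- Bilinear expansion of `(R, P) = P (S, 1) - q (1, 0)` with `q = P S - R`; the term in `P₁ P₂`
vanishes by the Riccati equation, and `D` disappears with it. -/
theorem riccatiForm_conj (hS : riccatiForm B c a D S₁ 1 S₂ 1 = 0) :
    riccatiForm B c a D R₁ P₁ R₂ P₂ = B * (P₁ * S₁ - R₁) * (P₂ * S₂ - R₂)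
      - (B * S₂ + (c + a)) * (P₁ * S₁ - R₁) * P₂ - (B * S₁ + (c - a)) * P₁ * (P₂ * S₂ - R₂) := by
  simp only [riccatiForm] at hS ⊢
  linear_combination P₁ * P₂ * hS

end Form

/-! ### Polynomiality of the transformed coefficients -/

namespace Lattice

variable (L : Lattice)

theorem D_eq (f : Series) : L.D f = (L.hom₂ f - L.hom₁ f) / L.Delta := by
  rw [D, E₁_eq, E₂_eq, Delta]

theorem M_eq (f : Series) : L.M f = (L.hom₁ f + L.hom₂ f) / 2 := by
  rw [M, E₁_eq, E₂_eq]

theorem riccatiForm_eq_zero {pA pB pC pD : ℂ[X]} {S : Series} (h : L.Riccati pA pB pC pD S) :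
    riccatiForm (ofPoly pB) (ofPoly pC / 2) (ofPoly pA / L.Delta) (ofPoly pD)
      (L.hom₁ S) 1 (L.hom₂ S) 1 = 0 := by
  have h0 := L.Delta_ne_zero
  rw [Riccati, D_eq, M_eq, E₁_eq, E₂_eq] at h
  rw [riccatiForm]
  linear_combination -h

theorem hom₁_C (w : ℂ) : L.hom₁ (ofPoly (C w)) = ofPoly (C w) := by
  rw [hom₁, GrowsLinearly.composeHom_ofPoly, aeval_C, ofPoly_C_eq_algebraMap]

theorem hom₂_C (w : ℂ) : L.hom₂ (ofPoly (C w)) = ofPoly (C w) := by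
  rw [hom₂, GrowsLinearly.composeHom_ofPoly, aeval_C, ofPoly_C_eq_algebraMap]

/-- Each entry is `m ∓ (Δ/2) d` with polynomials `m`, `d`. Exchanging the two roots also flips
`A/Δ`, so the expressions for `l` and `Θ` are even in `Δ` and the one for `π` is odd; the witnesses
are their explicit expansions. -/
theorem exists_transform (pA pB pC pD P R P' R' : ℂ[X]) {w : ℂ} (hw : w ≠ 0)
    (hW : P * R' - P' * R = C w) : ∃ l π Θ : ℂ[X],
    IsTransform (ofPoly pB) (ofPoly pC / 2) (ofPoly pA / L.Delta) (ofPoly pD) (ofPoly (C w))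
      (ofPoly l) (L.Delta * ofPoly π) (ofPoly Θ) (L.hom₁ (ofPoly P)) (L.hom₂ (ofPoly P))
      (L.hom₁ (ofPoly R)) (L.hom₂ (ofPoly R)) (L.hom₁ (ofPoly P')) (L.hom₂ (ofPoly P'))
      (L.hom₁ (ofPoly R')) (L.hom₂ (ofPoly R')) := by
  have h0 := L.Delta_ne_zero
  have hw1 : ofPoly (C w) * ofPoly (C w⁻¹) = 1 := by
    rw [← map_mul, ← C_mul, mul_inv_cancel₀ hw, map_one, map_one]
  have hh : ofPoly (C (1 / 2)) = 1 / 2 := by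
    rw [ofPoly_C_eq_algebraMap, map_div₀, map_one, map_ofNat (algebraMap ℂ Series) 2]
  have hW1 : L.hom₁ (ofPoly P) * L.hom₁ (ofPoly R') - L.hom₁ (ofPoly P') * L.hom₁ (ofPoly R) =
      ofPoly (C w) := by
    simpa only [map_sub, map_mul, hom₁_C] using congrArg (fun p => L.hom₁ (ofPoly p)) hW
  have hW2 : L.hom₂ (ofPoly P) * L.hom₂ (ofPoly R') - L.hom₂ (ofPoly P') * L.hom₂ (ofPoly R) =
      ofPoly (C w) := by
    simpa only [map_sub, map_mul, hom₂_C] using congrArg (fun p => L.hom₂ (ofPoly p)) hW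
  obtain ⟨mP, dP, hP1, hP2⟩ := L.exists_M_D_poly P
  obtain ⟨mR, dR, hR1, hR2⟩ := L.exists_M_D_poly R
  obtain ⟨mP', dP', hP1', hP2'⟩ := L.exists_M_D_poly P'
  obtain ⟨mR', dR', hR1', hR2'⟩ := L.exists_M_D_poly R'
  rw [hP1, hR1, hP1', hR1'] at hW1 ⊢
  rw [hP2, hR2, hP2', hR2'] at hW2 ⊢
  set k := C (1 / 2) * C (1 / 2) * L.deltaSq with hk
  have hk' : ofPoly k = (L.Delta / 2) ^ 2 := by
    rw [hk, map_mul, map_mul, ofPoly_deltaSq, hh]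
    ring
  have key : ∀ z, ofPoly (C w) * (ofPoly (C w⁻¹) * z) = z := fun z => by
    rw [← mul_assoc, hw1, one_mul]
  refine ⟨C w⁻¹ * (pB * (mR * mR' - k * dR * dR') + C (1 / 2) * (pC *
      (mR' * mP - k * dR' * dP + (mP' * mR - k * dP' * dR))) + C (1 / 2) * pA * (mR' * dP
      - dR' * mP - (mP' * dR - dP' * mR)) + pD * (mP * mP' - k * dP * dP')),
    C w⁻¹ * (C (1 / 2) * (pB * (mR' * dR - dR' * mR) + C (1 / 2) * pC *
      (mR' * dP - dR' * mP + mP' * dR - dP' * mR) + pD * (mP' * dP - dP' * mP)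
      + pA * (dP' * dR - dR' * dP))),
    C w⁻¹ * -(pB * (mR ^ 2 - k * dR ^ 2) + pC * (mR * mP - k * dR * dP)
      + pA * (mR * dP - dR * mP) + pD * (mP ^ 2 - k * dP ^ 2)), hW1, hW2, ?_, ?_, ?_⟩
  · rw [map_mul ofPoly (C w⁻¹), mul_assoc 2, key]
    simp only [map_add, map_sub, map_mul, hh, hk', riccatiForm]
    field_simp
    ring
  · rw [map_mul ofPoly (C w⁻¹), mul_assoc 2, mul_left_comm (ofPoly (C w)), key]
    -- The difference of the two forms alone can have a pole `A/Δ`. Replacing one `w` by the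
    -- Casoratian at `y₁` and the other by that at `y₂` leaves `A/Δ` times products of two
    -- differences, hence a multiple of `Δ`.
    rw [show 2 * ofPoly (C w) * (ofPoly pA / L.Delta) =
      (ofPoly (C w) + ofPoly (C w)) * (ofPoly pA / L.Delta) by ring]
    nth_rw 1 [← hW1]
    rw [← hW2]
    simp only [map_add, map_sub, map_mul, hh, riccatiForm]
    field_simp
    ring
  · rw [map_mul ofPoly (C w⁻¹), key]
    simp only [map_add, map_sub, map_mul, map_neg, map_pow, hk', riccatiForm]
    field_simp
    ring

end Lattice
-- Uniform degree bounds and the relations at level `n`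
theorem ofPoly_C_half : ofPoly (C (1 / 2)) = 1 / 2 := by
  rw [ofPoly_C_eq_algebraMap, map_div₀, map_one, map_ofNat (algebraMap ℂ Series) 2]

theorem IsBigO.div_two {f : Series} {m : ℤ} (h : IsBigO f m) : IsBigO (f / 2) m := by
  have := (isBigO_const (1 / 2)).mul h
  rwa [ofPoly_C_half, zero_add, one_div_mul_eq_div] at this

theorem IsBigO.of_const_mul {f : Series} {m : ℤ} {a : ℂ} (ha : a ≠ 0)
    (h : IsBigO (ofPoly (C a) * f) m) : IsBigO f m := by
  have := (isBigO_const a⁻¹).mul h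
  rwa [← mul_assoc, ← map_mul, ← C_mul, inv_mul_cancel₀ ha, map_one, map_one, one_mul,
    zero_add] at this

theorem IsBigO.of_two_mul {f : Series} {m : ℤ} (h : IsBigO (2 * f) m) : IsBigO f m := by
  simpa using h.div_two

namespace Lattice

variable (L : Lattice)

/-- `Δ²` is a nonzero polynomial, so multiplying by it cannot lower a degree; this spares a lower
bound on the growth of `Δ`. -/
theorem natDegree_le_of_isBigO_Delta_sq_mul {p : ℂ[X]} {N : ℕ}
    (h : IsBigO (L.Delta ^ 2 * ofPoly p) (-N)) : p.natDegree ≤ N := by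
  obtain rfl | h0 := eq_or_ne p 0
  · simp
  rw [← ofPoly_deltaSq, ← map_mul] at h
  have := natDegree_le_of_isBigO h
  rw [natDegree_mul L.deltaSq_ne_zero h0] at this
  lia

/-- By `riccatiForm_conj` each term pairs a `q = O(x ^ (-m))` with a factor `P = O(x ^ m)` or with
another `q`, so `m` drops out. The factor `Δ` clears the denominator of `A/Δ`. -/
theorem isBigO_Delta_mul_riccatiForm {pA pB pC pD : ℂ[X]} {N : ℕ} (hA : pA.natDegree ≤ N)
    (hB : pB.natDegree ≤ N) (hC : pC.natDegree ≤ N) {S₁ S₂ R₁ P₁ R₂ P₂ : Series}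
    (hS : riccatiForm (ofPoly pB) (ofPoly pC / 2) (ofPoly pA / L.Delta) (ofPoly pD) S₁ 1 S₂ 1 = 0)
    {m : ℕ} (hS₁ : IsBigO S₁ 0) (hS₂ : IsBigO S₂ 0) (hP₁ : IsBigO P₁ (-m)) (hP₂ : IsBigO P₂ (-m))
    (hq₁ : IsBigO (P₁ * S₁ - R₁) m) (hq₂ : IsBigO (P₂ * S₂ - R₂) m) :
    IsBigO (L.Delta * riccatiForm (ofPoly pB) (ofPoly pC / 2) (ofPoly pA / L.Delta) (ofPoly pD)
      R₁ P₁ R₂ P₂) (-(N + 1 : ℕ)) := by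
  have h0 := L.Delta_ne_zero
  have hΔ := L.isBigO_Delta
  replace hA := isBigO_ofPoly hA
  replace hB := isBigO_ofPoly hB
  replace hC := (isBigO_ofPoly hC).div_two
  rw [riccatiForm_conj hS, show ∀ b c a q₁ q₂ : Series,
      L.Delta * (b * q₁ * q₂ - (b * S₂ + (c + a / L.Delta)) * q₁ * P₂
        - (b * S₁ + (c - a / L.Delta)) * P₁ * q₂) =
      L.Delta * b * q₁ * q₂ - (L.Delta * (b * S₂ + c) + a) * q₁ * P₂
        - (L.Delta * (b * S₁ + c) - a) * P₁ * q₂ by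
    intro b c a q₁ q₂
    field_simp
    ring]
  have hK₁ := (hΔ.mul (((hB.mul hS₁).mono (k := -N) (by lia)).add hC)).mono
    (k := -(N + 1 : ℕ)) (by push_cast; lia)
  have hK₂ := (hΔ.mul (((hB.mul hS₂).mono (k := -N) (by lia)).add hC)).mono
    (k := -(N + 1 : ℕ)) (by push_cast; lia)
  have hA' := hA.mono (k := -(N + 1 : ℕ)) (by push_cast; lia)
  exact (((((hΔ.mul hB).mul hq₁).mul hq₂).mono (by push_cast; lia)).sub
    ((((hK₂.add hA').mul hq₁).mul hP₂).mono (by push_cast; lia))).sub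
    ((((hK₁.sub hA').mul hP₁).mul hq₂).mono (by push_cast; lia))

variable {u : ℕ → ℂ} {pA pB pC pD : ℂ[X]} {P : ℕ → ℂ[X]} {P1 : ℤ → ℂ[X]}

open IsPade

/-- At level `n` the polynomials `l`, `π`, `Θ` are those of index `n - 1` in the theorem, while `An`
is `A_n`. -/
theorem exists_structure_relations (hu : IsRegularMoments u)
    (hS : L.Riccati pA pB pC pD (stieltjes u)) (hP : IsPade (stieltjes u) P P1) {N : ℕ}
    (hA : pA.natDegree ≤ N) (hB : pB.natDegree ≤ N) (hC : pC.natDegree ≤ N) (n : ℕ) :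
    ∃ An l π Θ : ℂ[X],
      (An.natDegree ≤ N + 2 ∧ l.natDegree ≤ N + 2 ∧ π.natDegree ≤ N + 2 ∧ Θ.natDegree ≤ N + 2) ∧
      (n = 0 → l = C (1 / 2) * pC ∧ π = 0 ∧ Θ = pD) ∧
      ofPoly An = ofPoly pA + L.Delta ^ 2 / 2 * ofPoly π ∧
      ofPoly An * L.D (ofPoly (P n)) =
        (ofPoly l - ofPoly pC / 2) * L.M (ofPoly (P n))
          - ofPoly pB * L.M (ofPoly (P1 ((n : ℤ) - 1))) + ofPoly Θ * L.M (ofPoly (prevP P n)) ∧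
      ofPoly An * L.D (ofPoly (P1 ((n : ℤ) - 1))) =
        (ofPoly l + ofPoly pC / 2) * L.M (ofPoly (P1 ((n : ℤ) - 1)))
          + ofPoly pD * L.M (ofPoly (P n)) + ofPoly Θ * L.M (ofPoly (prevP1 P1 n)) ∧
      ofPoly An * L.D (secondKind (stieltjes u) P P1 n) =
        (ofPoly l + ofPoly pC / 2) * L.M (secondKind (stieltjes u) P P1 n)
          + ofPoly pB * (2 * L.M (stieltjes u) * L.M (secondKind (stieltjes u) P P1 n)
            - L.M (stieltjes u * secondKind (stieltjes u) P P1 n))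
          + ofPoly Θ * L.M (secondKind (stieltjes u) P P1 ((n : ℤ) - 1)) := by
  have h0 := L.Delta_ne_zero
  have hΔ := L.isBigO_Delta
  obtain ⟨w, hw, hW⟩ := hP.exists_casorati hu n
  obtain ⟨l, π, Θ, h⟩ := L.exists_transform pA pB pC pD _ _ _ _ hw hW
  have hw' : ofPoly (C w) ≠ 0 := by
    rw [ne_eq, map_eq_zero_iff _ ofPoly_injective]
    simpa using hw
  have hS' := L.riccatiForm_eq_zero hS
  have hAn : ofPoly (pA + C (1 / 2) * L.deltaSq * π) =
      ofPoly pA + L.Delta ^ 2 / 2 * ofPoly π := by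
    rw [map_add, map_mul, map_mul, ofPoly_deltaSq, ofPoly_C_half]
    ring
  have hq := secondKind_eq (P := P) (P1 := P1) (stieltjes u) n
  have hq' := secondKind_pred_eq (P := P) (P1 := P1) (stieltjes u) n
  -- Bounds deliberately weakened to one exponent `n` for both basis vectors, so that mixed products
  -- also balance.
  have bP := isBigO_ofPoly (hP.natDegree_eq n).le
  have bP' := isBigO_ofPoly (hP.natDegree_prevP_le n)
  have bq := (hP.isBigO_secondKind n).mono (k := n) (by lia)
  have bq' := hP.isBigO_secondKind_pred n
  have bS := (isBigO_stieltjes u).mono (k := 0) (by lia)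
  rw [hq] at bq
  rw [hq'] at bq'
  have t₁ : ∀ {f m}, IsBigO f m → IsBigO (L.hom₁ f) m := L.growsLinearly.1.isBigO_composeHom
  have t₂ : ∀ {f m}, IsBigO f m → IsBigO (L.hom₂ f) m := L.growsLinearly.2.isBigO_composeHom
  have bq₁ := t₁ bq
  have bq₂ := t₂ bq
  have bq₁' := t₁ bq'
  have bq₂' := t₂ bq'
  rw [map_sub, map_mul] at bq₁ bq₂ bq₁' bq₂'
  have bX := L.isBigO_Delta_mul_riccatiForm hA hB hC hS' (t₁ bS) (t₂ bS) (t₁ bP') (t₂ bP) bq₁' bq₂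
  have bX' := L.isBigO_Delta_mul_riccatiForm hA hB hC hS' (t₁ bS) (t₂ bS) (t₁ bP) (t₂ bP') bq₁ bq₂'
  have bH := L.isBigO_Delta_mul_riccatiForm hA hB hC hS' (t₁ bS) (t₂ bS) (t₁ bP) (t₂ bP) bq₁ bq₂
  have bA := (isBigO_ofPoly hA).mono (k := -(N + 1 : ℕ)) (by push_cast; lia)
  have bπ : IsBigO (L.Delta ^ 2 * ofPoly π) (-(N + 1 : ℕ)) := by
    refine .of_const_mul hw (.of_two_mul ?_)
    rw [show 2 * (ofPoly (C w) * (L.Delta ^ 2 * ofPoly π)) =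
      L.Delta * (2 * ofPoly (C w) * (L.Delta * ofPoly π)) by ring, h.π_eq, mul_sub, mul_sub]
    refine (bX.sub bX').sub ?_
    rw [show L.Delta * (2 * ofPoly (C w) * (ofPoly pA / L.Delta)) =
      ofPoly (C w) * (ofPoly pA + ofPoly pA) by field_simp; ring]
    exact ((isBigO_const w).mul (bA.add bA)).mono (by lia)
  refine ⟨pA + C (1 / 2) * L.deltaSq * π, l, π, Θ, ⟨?_, ?_, ?_, ?_⟩, ?_, hAn, ?_, ?_, ?_⟩
  · refine natDegree_le_of_isBigO ?_
    rw [hAn, div_mul_eq_mul_div]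
    exact (bA.add bπ.div_two).mono (by push_cast; lia)
  · refine L.natDegree_le_of_isBigO_Delta_sq_mul (.of_const_mul hw (.of_two_mul ?_))
    rw [show 2 * (ofPoly (C w) * (L.Delta ^ 2 * ofPoly l)) =
      L.Delta * (L.Delta * (2 * ofPoly (C w) * ofPoly l)) by ring, h.l_eq, mul_add L.Delta]
    exact (hΔ.mul (bX.add bX')).mono (by push_cast; lia)
  · exact L.natDegree_le_of_isBigO_Delta_sq_mul (bπ.mono (by push_cast; lia))
  · refine L.natDegree_le_of_isBigO_Delta_sq_mul (.of_const_mul hw ?_)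
    rw [show ofPoly (C w) * (L.Delta ^ 2 * ofPoly Θ) = -(L.Delta * (L.Delta *
      riccatiForm (ofPoly pB) (ofPoly pC / 2) (ofPoly pA / L.Delta) (ofPoly pD) _ _ _ _)) by
        linear_combination L.Delta ^ 2 * h.Θ_eq]
    exact (hΔ.mul bH).neg.mono (by push_cast; lia)
  -- At level `0` the basis is `(R, P) = (0, 1)`, `(R', P') = (-1, 0)` with `w = -1`, which returns
  -- the original coefficients.
  · rintro rfl
    obtain ⟨h1, -, hl, hπ, hΘ⟩ := h
    have e1 : P 0 = 1 := (hP.monic 0).natDegree_eq_zero.1 (hP.natDegree_eq 0)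
    have e2 : P1 (((0 : ℕ) : ℤ) - 1) = 0 := by simpa using hP.degree_lt 0
    simp only [e1, e2, prevP, prevP1, map_neg, map_one, map_zero, riccatiForm] at h1 hl hπ hΘ
    have hw1 : ofPoly (C w) = -1 := by rw [← h1]; ring
    rw [hw1] at hl hπ hΘ
    refine ⟨ofPoly_injective ?_, ofPoly_injective ?_, ofPoly_injective ?_⟩
    · rw [map_mul, ofPoly_C_half]
      linear_combination -hl / 2
    · rw [map_zero]
      refine (mul_eq_zero.1 ?_).resolve_left h0
      linear_combination -hπ / 2
    · linear_combination -hΘ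
  · rw [hAn, D_eq, M_eq, M_eq, M_eq, ← h.structure_P hw']
    field_simp
  · rw [hAn, D_eq, M_eq, M_eq, M_eq, ← h.structure_R hw']
    field_simp
  · rw [hq, hq', hAn, D_eq, M_eq, M_eq, M_eq, M_eq]
    simp only [map_sub, map_mul]
    rw [← h.structure_q hw' hS']
    field_simp

end Lattice
end LaguerreHahn

end

open LaguerreHahn in
theorem theorem2 (L : Lattice) (u : ℕ → ℂ) (hu : IsRegularMoments u)
    (pA pB pC pD : ℂ[X]) (hS : L.Riccati pA pB pC pD (stieltjes u))
    (P : ℕ → ℂ[X]) (P1 : ℤ → ℂ[X]) (hP : IsPade (stieltjes u) P P1)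
    (q : ℤ → Series) (hq : q = secondKind (stieltjes u) P P1) :
    ∃ (An : ℕ → ℂ[X]) (l π Θ : ℤ → ℂ[X]),
      -- uniformly bounded degrees
      (∃ N : ℕ, (∀ n : ℕ, (An n).natDegree ≤ N) ∧
        ∀ n : ℤ, -1 ≤ n → (l n).natDegree ≤ N ∧ (π n).natDegree ≤ N ∧ (Θ n).natDegree ≤ N) ∧
      -- initial values
      (l (-1) = C (1 / 2) * pC ∧ π (-1) = 0 ∧ Θ (-1) = pD) ∧
      -- the polynomials `A_n`
      (∀ n : ℕ, ofPoly (An n) = ofPoly pA + L.Delta ^ 2 / 2 * ofPoly (π ((n : ℤ) - 1))) ∧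
      -- the structure relations
      ∀ n : ℕ,
        ofPoly (An (n + 1)) * L.D (ofPoly (P (n + 1))) =
            (ofPoly (l n) - ofPoly pC / 2) * L.M (ofPoly (P (n + 1)))
              - ofPoly pB * L.M (ofPoly (P1 n))
              + ofPoly (Θ n) * L.M (ofPoly (P n)) ∧
        ofPoly (An (n + 1)) * L.D (ofPoly (P1 n)) =
            (ofPoly (l n) + ofPoly pC / 2) * L.M (ofPoly (P1 n))
              + ofPoly pD * L.M (ofPoly (P (n + 1)))
              + ofPoly (Θ n) * L.M (ofPoly (P1 ((n : ℤ) - 1))) ∧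
        ofPoly (An n) * L.D (q n) =
            (ofPoly (l ((n : ℤ) - 1)) + ofPoly pC / 2) * L.M (q n)
              + ofPoly pB * (2 * L.M (stieltjes u) * L.M (q n) - L.M (stieltjes u * q n))
              + ofPoly (Θ ((n : ℤ) - 1)) * L.M (q ((n : ℤ) - 1)) := by
  subst hq
  obtain ⟨N, hA, hB, hC⟩ : ∃ N, pA.natDegree ≤ N ∧ pB.natDegree ≤ N ∧ pC.natDegree ≤ N :=
    ⟨max pA.natDegree (max pB.natDegree pC.natDegree), by simp, by simp, by simp⟩
  choose An l π Θ hdeg hinit hAn h1 h2 h3 using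
    fun n => L.exists_structure_relations hu hS hP hA hB hC n
  have hn : ∀ n : ℕ, ((n : ℤ) - 1 + 1).toNat = n := fun n => by simp
  -- Index `n` is level `n + 1`, so `-1` is level `0`. The relations for `P` and `P1` are taken at
  -- level `n + 1`, the one for `q` at level `n`.
  refine ⟨An, fun n => l (n + 1).toNat, fun n => π (n + 1).toNat, fun n => Θ (n + 1).toNat,
    ⟨N + 2, fun n => (hdeg n).1, fun n _ => (hdeg _).2⟩, hinit 0 rfl, fun n => ?_,
    fun n => ⟨?_, ?_, ?_⟩⟩
  · simpa only [hn] using hAn n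
  · simpa [IsPade.prevP] using h1 (n + 1)
  · simpa [IsPade.prevP1] using h2 (n + 1)
  · simpa only [hn] using h3 n
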